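/- **Setting.** Let $(X,d,\mu)$ be a metric measure space: $(X,d)$ is a metric space and $\mu$ is a Borel measure with $0<\mu(B(x,r))<\infty$ for every open ball $B(x,r)$, $r>0$. *Exponents.* $\mathcal P(X)$ is the set of measurable $q:X\to(0,\infty]$ with $q^-:=\operatorname{ess\,inf}_X q>0$; $\mathcal P_b(X)$ is the set of (essentially) bounded real-valued members of $\mathcal P(X)$; and $\mathcal P_b^{\log}(X)$ is the set of $p\in\mathcal P_b(X)$ for which there is $C>0$ with $$\left|\tfrac1{p(x)}-\tfrac1{p(y)}\right|\le \frac{C}{\log(e+1/d(x,y))}\qquad\text{for all distinct }x,y\in X.$$ For $p,q\in\mathcal P_b(X)$, $p\ll q$ (equivalently $q\gg p$) means $\operatorname{ess\,inf}_X(q-p)>0$. *Function spaces.* For $p\in\mathcal P_b(X)$ and measurable $f$ with values in $[-\infty,\infty]$, let $\rho_{p(\cdot)}(f)=\int_X|f|^{p(x)}\,d\mu$ and $\|f\|_{L^{p(\cdot)}}=\inf\{\lambda>0:\rho_{p(\cdot)}(f/\lambda)\le1\}$ (always $\inf\emptyset=\infty$). $L^{p(\cdot)}(X)$ is the space of measurable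 $u:X\to\mathbb R$ with $\rho_{p(\cdot)}(u)<\infty$. For a sequence $g=(g_k)_{k\in\mathbb Z}$ of measurable functions $g_k:X\to[0,\infty]$ and $q\in\mathcal P(X)$, let $$\|g\|_{L^{p(\cdot)}(\ell^{q(\cdot)})}=\Big\|\,x\mapsto\|(g_k(x))_{k}\|_{\ell^{q(x)}}\Big\|_{L^{p(\cdot)}},\qquad \|g\|_{\ell^{q(\cdot)}(L^{p(\cdot)})}=\inf\{\lambda>0:\rho(g/\lambda)\le1\},$$ where $\rho(g)=\sum_{k\in\mathbb Z}\inf\{\lambda>0:\rho_{p(\cdot)}(g_k\lambda^{-1/q(\cdot)})\le1\}$ and $\lambda^{1/\infty}:=1$. For $s\in\mathcal P_b(X)$ and measurable $u:X\to\mathbb R$, let $\mathbb D^{s(\cdot)}(u)$ be the set of such $g$ for which there is a $\mu$-null set $N$ with $$|u(x)-u(y)|\le d(x,y)^{s(x)}g_k(x)+d(x,y)^{s(y)}g_k(y)$$ for all $k\in\mathbb Z$ and $x,y\in X\setminus N$ with $2^{-k-1}\le d(x,y)<2^{-k}$. The Hajłasz–Triebel–Lizorkin space $M^{s(\cdot)}_{p(\cdot),q(\cdot)}(X)$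 and the Hajłasz–Besov space $N^{s(\cdot)}_{p(\cdot),q(\cdot)}(X)$ consist of the $u\in L^{p(\cdot)}(X)$ for which, respectively, $$\|u\|_{M}:=\|u\|_{L^{p(\cdot)}}+\inf_{g\in\mathbb D^{s(\cdot)}(u)}\|g\|_{L^{p(\cdot)}(\ell^{q(\cdot)})}<\infty,\qquad \|u\|_{N}:=\|u\|_{L^{p(\cdot)}}+\inf_{g\in\mathbb D^{s(\cdot)}(u)}\|g\|_{\ell^{q(\cdot)}(L^{p(\cdot)})}<\infty.$$ A continuous embedding $E\hookrightarrow L^{r(\cdot)}(X)$ means that $E\subseteq L^{r(\cdot)}(X)$ and there is $C<\infty$ with $\|u\|_{L^{r(\cdot)}}\le C\|u\|_E$ for all $u\in E$. **Theorem.** Suppose that $(X,d)$ is geometrically doubling (there is $M$ such that every ball $B(x,r)$ can be covered by at most $M$ balls of radius $r/2$), that $\sup_{x\in X}\mu(B(x,\delta))<\infty$ for some $\delta\in(0,\infty)$, and that $\mu$ is lower Ahlfors $Q(\cdot)$-regular for some $Q\in\mathcal P^{\log}_b(X)$ (there is $b>0$ with $\mu(B(x,r))\ge b\,r^{Q(x)}$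 for all $x\in X$ and $r\in(0,1]$). Let $p,s\in\mathcal P^{\log}_b(X)$ satisfy $sp=Q$ on $X$. Then: 1. for every $q\in\mathcal P(X)$ and every $\beta\in\mathcal P_b(X)$ with $\beta\gg p$, $M^{s(\cdot)}_{p(\cdot),q(\cdot)}(X)\hookrightarrow L^{\beta(\cdot)}(X)$; 2. for every $q\in\mathcal P(X)$ with $q\le p$ and every $\beta\in\mathcal P_b(X)$ with $\beta\gg p$, $N^{s(\cdot)}_{p(\cdot),q(\cdot)}(X)\hookrightarrow L^{\beta(\cdot)}(X)$; 3. for every $q\in\mathcal P(X)$ and every $t\in\mathcal P^{\log}_b(X)$ with $t\ll s$, $N^{s(\cdot)}_{p(\cdot),q(\cdot)}(X)\hookrightarrow L^{\sigma(\cdot)}(X)$, where $\sigma:=\dfrac{Qp}{Q-tp}$. -/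

import Mathlib

open MeasureTheory
open scoped ENNReal NNReal

namespace VarHajlasz

/-! ### Metric measure spaces -/

/-- Every ball of positive radius has positive and finite measure. -/
def IsMetricMeasure {X : Type*} [MetricSpace X] [MeasurableSpace X] (μ : Measure X) : Prop :=
  ∀ (x : X) (r : ℝ), 0 < r → 0 < μ (Metric.ball x r) ∧ μ (Metric.ball x r) < ∞

/-- Every ball can be covered by at most `M` balls of half the radius. -/
def GeometricallyDoubling (X : Type*) [MetricSpace X] : Prop :=
  ∃ M : ℕ, ∀ (x : X) (r : ℝ), 0 < r →
    ∃ F : Finset X, F.card ≤ M ∧ Metric.ball x r ⊆ ⋃ y ∈ F, Metric.ball y (r / 2)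

/-- Lower Ahlfors `Q(·)`-regularity: `μ (B(x,r)) ≥ b r^{Q(x)}` for all `x` and `0 < r ≤ 1`. -/
def LowerAhlforsRegular {X : Type*} [MetricSpace X] [MeasurableSpace X] (μ : Measure X)
    (Q : X → ℝ) : Prop :=
  ∃ b : ℝ, 0 < b ∧ ∀ (x : X) (r : ℝ), 0 < r → r ≤ 1 →
    ENNReal.ofReal (b * r ^ Q x) ≤ μ (Metric.ball x r)

/-! ### Variable exponents -/

/-- The class `𝒫(X)`: measurable `q : X → (0, ∞]` with positive essential infimum. -/
structure IsExponent {X : Type*} [MeasurableSpace X] (μ : Measure X) (q : X → ℝ≥0∞) : Prop where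
  measurable : Measurable q
  pos : ∀ x, 0 < q x
  essInf_pos : 0 < essInf q μ

/-- The class `𝒫_b(X)`: (essentially) bounded exponents, written as real-valued functions. -/
structure IsBddExponent {X : Type*} [MeasurableSpace X] (μ : Measure X) (p : X → ℝ) : Prop where
  measurable : Measurable p
  pos : ∀ x, 0 < p x
  bdd_below : ∃ c : ℝ, 0 < c ∧ ∀ᵐ x ∂μ, c ≤ p x
  bdd_above : ∃ C : ℝ, ∀ᵐ x ∂μ, p x ≤ C

/-- Local log-Hölder continuity on the whole space. For `x = y` the inequality reads `0 ≤ C`. -/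
def LogHolder {X : Type*} [MetricSpace X] (f : X → ℝ) : Prop :=
  ∃ C : ℝ, 0 < C ∧ ∀ x y : X, |f x - f y| ≤ C / Real.log (Real.exp 1 + 1 / dist x y)

/-- The class `𝒫_b^log(X)`: bounded exponents whose reciprocal is log-Hölder continuous. -/
structure IsLogExponent {X : Type*} [MetricSpace X] [MeasurableSpace X] (μ : Measure X)
    (p : X → ℝ) : Prop extends IsBddExponent μ p where
  logHolder : LogHolder fun x => 1 / p x

/-- `p ≪ q`, that is, the essential infimum of `q - p` is positive. -/
def StronglyLess {X : Type*} [MeasurableSpace X] (μ : Measure X) (p q : X → ℝ) : Prop :=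
  ∃ c : ℝ, 0 < c ∧ ∀ᵐ x ∂μ, c ≤ q x - p x

/-! ### Variable exponent Lebesgue spaces -/

/-- The semi-modular `ρ_{p(·)}(f) = ∫ f(x)^{p(x)} dμ(x)` of a `[0, ∞]`-valued function. -/
noncomputable def modular {X : Type*} [MeasurableSpace X] (μ : Measure X) (p : X → ℝ)
    (f : X → ℝ≥0∞) : ℝ≥0∞ :=
  ∫⁻ x, f x ^ p x ∂μ

/-- The Luxemburg quasi-norm `inf {l > 0 : ρ_{p(·)}(f / l) ≤ 1}`, with `inf ∅ = ∞`. -/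
noncomputable def luxNorm {X : Type*} [MeasurableSpace X] (μ : Measure X) (p : X → ℝ)
    (f : X → ℝ≥0∞) : ℝ≥0∞ :=
  ⨅ (l : ℝ≥0) (_ : 0 < l ∧ modular μ p (fun x => f x / l) ≤ 1), (l : ℝ≥0∞)

/-- The space `L^{p(·)}(X, μ)` of measurable real-valued functions with finite semi-modular. -/
def lpSpace {X : Type*} [MeasurableSpace X] (μ : Measure X) (p : X → ℝ) : Set (X → ℝ) :=
  {u | Measurable u ∧ modular μ p (fun x => ‖u x‖ₑ) < ∞}

/-! ### Mixed Lebesgue sequence spaces -/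

open Classical in
/-- The `ℓ^q` quasi-norm of a `[0, ∞]`-valued two-sided sequence, `0 < q ≤ ∞`. -/
noncomputable def seqNorm (q : ℝ≥0∞) (a : ℤ → ℝ≥0∞) : ℝ≥0∞ :=
  if q = ∞ then ⨆ k, a k else (∑' k, a k ^ q.toReal) ^ (1 / q.toReal)

/-- The quasi-norm of `L^{p(·)}(ℓ^{q(·)})`. -/
noncomputable def lpSeqNorm {X : Type*} [MeasurableSpace X] (μ : Measure X) (p : X → ℝ)
    (q : X → ℝ≥0∞) (g : ℤ → X → ℝ≥0∞) : ℝ≥0∞ :=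
  luxNorm μ p fun x => seqNorm (q x) fun k => g k x

/-- The semi-modular of `ℓ^{q(·)}(L^{p(·)})`, namely
`∑_k inf {l > 0 : ρ_{p(·)}(g_k / l^{1/q(·)}) ≤ 1}`, with the convention `l^{1/∞} = 1`. -/
noncomputable def seqLpModular {X : Type*} [MeasurableSpace X] (μ : Measure X) (p : X → ℝ)
    (q : X → ℝ≥0∞) (g : ℤ → X → ℝ≥0∞) : ℝ≥0∞ :=
  ∑' k, ⨅ (l : ℝ≥0) (_ : 0 < l ∧
    modular μ p (fun x => g k x / (l : ℝ≥0∞) ^ ((q x)⁻¹).toReal) ≤ 1), (l : ℝ≥0∞)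

/-- The quasi-norm of `ℓ^{q(·)}(L^{p(·)})`. -/
noncomputable def seqLpNorm {X : Type*} [MeasurableSpace X] (μ : Measure X) (p : X → ℝ)
    (q : X → ℝ≥0∞) (g : ℤ → X → ℝ≥0∞) : ℝ≥0∞ :=
  ⨅ (l : ℝ≥0) (_ : 0 < l ∧ seqLpModular μ p q (fun k x => g k x / l) ≤ 1), (l : ℝ≥0∞)

/-! ### Hajłasz–Triebel–Lizorkin and Hajłasz–Besov spaces -/

/-- The vector `s(·)`-gradients of `u`: sequences `(g_k)` of measurable functions
`g_k : X → [0, ∞]` such that, off a null set,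
`|u(x) - u(y)| ≤ d(x,y)^{s(x)} g_k(x) + d(x,y)^{s(y)} g_k(y)`
whenever `2^{-k-1} ≤ d(x,y) < 2^{-k}`. -/
def vectorGradients {X : Type*} [MetricSpace X] [MeasurableSpace X] (μ : Measure X) (s : X → ℝ)
    (u : X → ℝ) : Set (ℤ → X → ℝ≥0∞) :=
  {g | (∀ k, Measurable (g k)) ∧ ∃ N : Set X, μ N = 0 ∧
    ∀ (k : ℤ) (x y : X), x ∉ N → y ∉ N →
      (2 : ℝ) ^ (-k - 1) ≤ dist x y → dist x y < (2 : ℝ) ^ (-k) →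
      ENNReal.ofReal |u x - u y| ≤
        ENNReal.ofReal (dist x y ^ s x) * g k x + ENNReal.ofReal (dist x y ^ s y) * g k y}

/-- The homogeneous Hajłasz–Triebel–Lizorkin quasi-seminorm. -/
noncomputable def tlSeminorm {X : Type*} [MetricSpace X] [MeasurableSpace X] (μ : Measure X)
    (s p : X → ℝ) (q : X → ℝ≥0∞) (u : X → ℝ) : ℝ≥0∞ :=
  ⨅ g ∈ vectorGradients μ s u, lpSeqNorm μ p q g

/-- The homogeneous Hajłasz–Besov quasi-seminorm. -/
noncomputable def besovSeminorm {X : Type*} [MetricSpace X] [MeasurableSpace X] (μ : Measure X)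
    (s p : X → ℝ) (q : X → ℝ≥0∞) (u : X → ℝ) : ℝ≥0∞ :=
  ⨅ g ∈ vectorGradients μ s u, seqLpNorm μ p q g

/-- The inhomogeneous Hajłasz–Triebel–Lizorkin space `M^{s(·)}_{p(·),q(·)}(X)`. -/
def tlSpace {X : Type*} [MetricSpace X] [MeasurableSpace X] (μ : Measure X)
    (s p : X → ℝ) (q : X → ℝ≥0∞) : Set (X → ℝ) :=
  {u | u ∈ lpSpace μ p ∧ tlSeminorm μ s p q u < ∞}

/-- The quasi-norm of `M^{s(·)}_{p(·),q(·)}(X)`. -/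
noncomputable def tlNorm {X : Type*} [MetricSpace X] [MeasurableSpace X] (μ : Measure X)
    (s p : X → ℝ) (q : X → ℝ≥0∞) (u : X → ℝ) : ℝ≥0∞ :=
  luxNorm μ p (fun x => ‖u x‖ₑ) + tlSeminorm μ s p q u

/-- The inhomogeneous Hajłasz–Besov space `N^{s(·)}_{p(·),q(·)}(X)`. -/
def besovSpace {X : Type*} [MetricSpace X] [MeasurableSpace X] (μ : Measure X)
    (s p : X → ℝ) (q : X → ℝ≥0∞) : Set (X → ℝ) :=
  {u | u ∈ lpSpace μ p ∧ besovSeminorm μ s p q u < ∞}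

/-- The quasi-norm of `N^{s(·)}_{p(·),q(·)}(X)`. -/
noncomputable def besovNorm {X : Type*} [MetricSpace X] [MeasurableSpace X] (μ : Measure X)
    (s p : X → ℝ) (q : X → ℝ≥0∞) (u : X → ℝ) : ℝ≥0∞ :=
  luxNorm μ p (fun x => ‖u x‖ₑ) + besovSeminorm μ s p q u

/-- The continuous embedding of a function space `E` with quasi-norm `normE` into `L^{r(·)}`. -/
def EmbedsInLp {X : Type*} [MeasurableSpace X] (μ : Measure X) (E : Set (X → ℝ))
    (normE : (X → ℝ) → ℝ≥0∞) (r : X → ℝ) : Prop :=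
  ∃ C : ℝ≥0, ∀ u ∈ E, u ∈ lpSpace μ r ∧ luxNorm μ r (fun x => ‖u x‖ₑ) ≤ C * normE u

end VarHajlasz

/-!
Let `g` be a vector gradient of `u` and put `w = max |u| (sup_{k ≥ 0} 2^{-kε} g_k)`. Trading an
`ε` of smoothness for summability over the scales, `w` has finite modular and is a gradient of `u`
of order `s - ε` on all distances less than `1`. Suppose `w x ≤ 2t` with `t` large. In the ball
around `x` of radius `t^{-(1-κ)/s(x)}`, whose measure is at least a multiple of `t^{-(1-κ)p(x)}`
because `Q = sp`, Chebyshev's inequality produces a point `y` with `w y ≤ t`, and the gradient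
inequality gives `|u x - u y| ≤ 3 t^{1-(1-κ)²} ≤ 3 t^{2κ}`; the exponents at `y` are comparable to
those at `x` because `p` and `s` are uniformly continuous. Halving the level of `w` repeatedly, we
reach a bounded level after summing a geometric series, so `|u| ≤ C max(1, w)^{2κ}`. As `κ` is
arbitrary, `|u|^β ≤ D w^p` for every bounded `β ≥ p`.
-/

namespace VarHajlasz

/-! ### Continuous exponents -/

section Exponents

variable {X : Type*} [MetricSpace X] {p : X → ℝ}

lemma LogHolder.uniformContinuous (hp : LogHolder p) : UniformContinuous p := by
  obtain ⟨C, -, h⟩ := hp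
  have hlim : Filter.Tendsto (fun d : ℝ => C / Real.log (Real.exp 1 + 1 / d))
      (nhdsWithin 0 (Set.Ioi 0)) (nhds 0) := by
    simp only [one_div]
    exact (Real.tendsto_log_atTop.comp
      (Filter.tendsto_atTop_add_const_left _ _ tendsto_inv_nhdsGT_zero)).const_div_atTop C
  refine Metric.uniformContinuous_iff.2 fun ε hε => ?_
  obtain ⟨δ, hδ, hδε⟩ := mem_nhdsGT_iff_exists_Ioo_subset.1 (hlim.eventually_lt_const hε)
  refine ⟨δ, hδ, fun x y hxy => ?_⟩
  rcases eq_or_ne x y with rfl | hne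
  · simpa using hε
  · exact (h x y).trans_lt (hδε ⟨dist_pos.2 hne, hxy⟩)

variable [MeasurableSpace X] {μ : Measure X}

lemma LowerAhlforsRegular.isOpenPosMeasure {Q : X → ℝ} (h : LowerAhlforsRegular μ Q) :
    μ.IsOpenPosMeasure := by
  obtain ⟨b, hb, h⟩ := h
  refine ⟨fun U hU ⟨x, hx⟩ => ?_⟩
  obtain ⟨ε, hε, hεU⟩ := Metric.isOpen_iff.1 hU x hx
  have hr : 0 < min ε 1 := lt_min hε one_pos
  have hball : 0 < μ (Metric.ball x (min ε 1)) :=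
    (ENNReal.ofReal_pos.2 (by positivity)).trans_le (h x _ hr (min_le_right _ _))
  exact (hball.trans_le
    (measure_mono ((Metric.ball_subset_ball (min_le_left _ _)).trans hεU))).ne'

variable [μ.IsOpenPosMeasure]

lemma forall_le_of_ae_le (hp : Continuous p) {c : ℝ} (h : ∀ᵐ x ∂μ, c ≤ p x) (x : X) : c ≤ p x :=
  (Measure.dense_of_ae h).induction (fun _ hx => hx) (isClosed_le continuous_const hp) x

lemma forall_ge_of_ae_ge (hp : Continuous p) {c : ℝ} (h : ∀ᵐ x ∂μ, p x ≤ c) (x : X) : p x ≤ c :=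
  (Measure.dense_of_ae h).induction (fun _ hx => hx) (isClosed_le hp continuous_const) x

lemma IsLogExponent.uniformContinuous (hp : IsLogExponent μ p) : UniformContinuous p := by
  obtain ⟨C, hC⟩ := hp.bdd_above
  have hinv : UniformContinuous fun x => 1 / p x := hp.logHolder.uniformContinuous
  have hae : ∀ᵐ x ∂μ, 1 / max C 1 ≤ 1 / p x := by
    filter_upwards [hC] with x hx
    exact one_div_le_one_div_of_le (hp.pos x) (hx.trans (le_max_left _ _))
  have hle := forall_le_of_ae_le hinv.continuous hae
  have hC0 : 0 < 1 / max C 1 := one_div_pos.2 (lt_max_of_lt_right one_pos)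
  have hrange : (Set.range fun x => 1 / p x)ᶜ ∈ nhds (0 : ℝ) := by
    filter_upwards [Iio_mem_nhds hC0]
    rintro _ hy ⟨x, rfl⟩
    exact (hle x).not_gt hy
  simpa [Pi.inv_def] using hinv.inv₀ hrange

end Exponents

/-! ### Descent along the level sets of a gradient -/

/-- Off `N`, the function `w` is a Hajłasz gradient of `u` of order `σ(·)` for all distances
less than `1`. Unlike a vector gradient it is a single function, serving all dyadic scales. -/
def HasLocalGradientOff {X : Type*} [MetricSpace X] (N : Set X) (σ u : X → ℝ) (w : X → ℝ≥0∞) :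
    Prop :=
  ∀ x ∉ N, ∀ y ∉ N, dist x y < 1 → ENNReal.ofReal |u x - u y| ≤
    ENNReal.ofReal (dist x y ^ σ x) * w x + ENNReal.ofReal (dist x y ^ σ y) * w y

lemma HasLocalGradientOff.mono {X : Type*} [MetricSpace X] {N : Set X} {σ u : X → ℝ}
    {w w' : X → ℝ≥0∞} (h : HasLocalGradientOff N σ u w) (hw : ∀ x, w x ≤ w' x) :
    HasLocalGradientOff N σ u w' := fun x hx y hy hd =>
  (h x hx y hy hd).trans <|
    add_le_add (mul_le_mul_right (hw x) _) (mul_le_mul_right (hw y) _)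

lemma HasLocalGradientOff.abs_sub_le {X : Type*} [MetricSpace X] {N : Set X} {σ u : X → ℝ}
    {w : X → ℝ≥0∞} (h : HasLocalGradientOff N σ u w) {x y : X} (hx : x ∉ N) (hy : y ∉ N)
    {a r v v' : ℝ} (ha : 0 ≤ a) (hax : a ≤ σ x) (hay : a ≤ σ y) (hr : r ≤ 1) (hxy : dist x y < r)
    (hv : 0 ≤ v) (hwx : w x ≤ ENNReal.ofReal v) (hv' : 0 ≤ v') (hwy : w y ≤ ENNReal.ofReal v') :
    |u x - u y| ≤ r ^ a * (v + v') := by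
  have hr0 : 0 < r := dist_nonneg.trans_lt hxy
  have hpow : ∀ e, a ≤ e → dist x y ^ e ≤ r ^ a := fun e he =>
    (Real.rpow_le_rpow dist_nonneg hxy.le (ha.trans he)).trans
      (Real.rpow_le_rpow_of_exponent_ge hr0 hr he)
  rw [← ENNReal.ofReal_le_ofReal_iff (by positivity)]
  calc ENNReal.ofReal |u x - u y|
      ≤ ENNReal.ofReal (dist x y ^ σ x) * w x + ENNReal.ofReal (dist x y ^ σ y) * w y :=
        h x hx y hy (hxy.trans_le hr)
    _ ≤ ENNReal.ofReal (r ^ a) * ENNReal.ofReal v + ENNReal.ofReal (r ^ a) * ENNReal.ofReal v' := by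
        gcongr
        exacts [hpow _ hax, hpow _ hay]
    _ = ENNReal.ofReal (r ^ a * (v + v')) := by
        rw [← mul_add, ← ENNReal.ofReal_add hv hv', ← ENNReal.ofReal_mul (by positivity)]

lemma exists_mem_le_of_modular_lt {X : Type*} [MeasurableSpace X] {μ : Measure X} {p : X → ℝ}
    {w : X → ℝ≥0∞} {t : ℝ≥0∞} {N B : Set X} (hN : μ N = 0) (hB : MeasurableSet B) (ht : 1 ≤ t)
    {a : ℝ} (ha0 : 0 ≤ a) (ha : ∀ y ∈ B, a ≤ p y) (h : modular μ p w < t ^ a * μ B) :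
    ∃ y ∈ B, y ∉ N ∧ w y ≤ t := by
  by_contra! hlt
  refine h.not_ge ?_
  calc t ^ a * μ B = ∫⁻ _ in B, t ^ a ∂μ := (setLIntegral_const _ _).symm
    _ ≤ ∫⁻ y in B, w y ^ p y ∂μ := by
        refine setLIntegral_mono_ae' hB ?_
        filter_upwards [measure_eq_zero_iff_ae_notMem.1 hN] with y hyN hy
        calc t ^ a ≤ t ^ p y := ENNReal.rpow_le_rpow_of_exponent_le ht (ha y hy)
          _ ≤ w y ^ p y := ENNReal.rpow_le_rpow (hlt y hy hyN).le (ha0.trans (ha y hy))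
    _ ≤ modular μ p w := setLIntegral_le_lintegral _ _

lemma self_mul_rpow_rpow_le {t κ σ : ℝ} (ht : 1 ≤ t) (hσ : 0 < σ) :
    t * (t ^ (-((1 - κ) / σ))) ^ ((1 - κ) * σ) ≤ t ^ (2 * κ) := by
  have ht0 : 0 < t := one_pos.trans_le ht
  calc t * (t ^ (-((1 - κ) / σ))) ^ ((1 - κ) * σ) = t ^ (1 - (1 - κ) ^ 2) := by
        rw [← Real.rpow_mul ht0.le, sub_eq_add_neg 1 ((1 - κ) ^ 2), Real.rpow_add ht0,
          Real.rpow_one]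
        congr 2
        field_simp
    _ ≤ t ^ (2 * κ) := Real.rpow_le_rpow_of_exponent_le ht (by nlinarith [sq_nonneg κ])

section Descent

variable {X : Type*} [MetricSpace X] {p s : X → ℝ}

lemma exists_mem_ball_le_of_critical [MeasurableSpace X] [BorelSpace X] {μ : Measure X}
    {w : X → ℝ≥0∞} {N : Set X} (hN : μ N = 0) {b p₁ κ K t r : ℝ} {x : X} (hb : 0 < b)
    (hp₁ : 0 < p₁) (hκ : 0 < κ) (hκ1 : κ < 1) (ht : 1 ≤ t) (htK : K < b * t ^ (κ * p₁ / 2))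
    (hw : modular μ p w ≤ ENNReal.ofReal K) (hpx : p₁ ≤ p x) (hsx : 0 < s x)
    (hr : r = t ^ (-((1 - κ) / s x)))
    (hball : ENNReal.ofReal (b * r ^ (s x * p x)) ≤ μ (Metric.ball x r))
    (hosc : ∀ y ∈ Metric.ball x r, p x - κ * p₁ / 2 ≤ p y) :
    ∃ y ∈ Metric.ball x r, y ∉ N ∧ w y ≤ ENNReal.ofReal t := by
  have ht0 : 0 < t := one_pos.trans_le ht
  have hr0 : 0 < r := hr ▸ Real.rpow_pos_of_pos ht0 _
  have hexp : κ * p₁ / 2 ≤ p x - κ * p₁ / 2 + -((1 - κ) / s x) * (s x * p x) := by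
    have hcancel : -((1 - κ) / s x) * (s x * p x) = -(1 - κ) * p x := by field_simp
    nlinarith
  have hpow : b * t ^ (κ * p₁ / 2) ≤ t ^ (p x - κ * p₁ / 2) * (b * r ^ (s x * p x)) := by
    rw [hr, ← Real.rpow_mul ht0.le, mul_left_comm, ← Real.rpow_add ht0]
    gcongr
  refine exists_mem_le_of_modular_lt hN Metric.isOpen_ball.measurableSet
    (ENNReal.one_le_ofReal.2 ht) (by nlinarith) hosc ?_
  calc modular μ p w ≤ ENNReal.ofReal K := hw
    _ < ENNReal.ofReal (t ^ (p x - κ * p₁ / 2) * (b * r ^ (s x * p x))) :=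
        (ENNReal.ofReal_lt_ofReal_iff (by positivity)).2 (htK.trans_le hpow)
    _ ≤ ENNReal.ofReal t ^ (p x - κ * p₁ / 2) * μ (Metric.ball x r) := by
        rw [ENNReal.ofReal_mul (by positivity), ENNReal.ofReal_rpow_of_pos ht0]
        gcongr

theorem eventually_exists_descent [MeasurableSpace X] [BorelSpace X] {μ : Measure X}
    (hreg : LowerAhlforsRegular μ fun x => s x * p x) (hpc : UniformContinuous p)
    (hsc : UniformContinuous s) {p₁ s₁ s₂ : ℝ} (hp₁ : 0 < p₁) (hp : ∀ x, p₁ ≤ p x)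
    (hs₁ : 0 < s₁) (hs : ∀ x, s₁ ≤ s x) (hs₂ : ∀ x, s x ≤ s₂) {κ ε : ℝ} (hκ : 0 < κ)
    (hκ1 : κ < 1) (hε : 0 < ε) (hεκ : 2 * ε ≤ κ * s₁) (K : ℝ) :
    ∀ᶠ t : ℝ in Filter.atTop, ∀ (u : X → ℝ) (w : X → ℝ≥0∞) (N : Set X), μ N = 0 →
      modular μ p w ≤ ENNReal.ofReal K → HasLocalGradientOff N (fun x => s x - ε) u w →
      ∀ x ∉ N, w x ≤ ENNReal.ofReal (2 * t) →
        ∃ y ∉ N, w y ≤ ENNReal.ofReal t ∧ |u x - u y| ≤ 3 * t ^ (2 * κ) := by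
  obtain ⟨b, hb, hreg⟩ := hreg
  obtain ⟨δp, hδp, hosc_p⟩ := Metric.uniformContinuous_iff.1 hpc (κ * p₁ / 2) (by positivity)
  obtain ⟨δs, hδs, hosc_s⟩ := Metric.uniformContinuous_iff.1 hsc ε hε
  rcases isEmpty_or_nonempty X with _ | ⟨⟨x₀⟩⟩
  · exact .of_forall fun t u w N _ _ _ x => isEmptyElim x
  have hs₂0 : 0 < s₂ := hs₁.trans_le ((hs x₀).trans (hs₂ x₀))
  have hlarge : ∀ᶠ t : ℝ in Filter.atTop, K < b * t ^ (κ * p₁ / 2) :=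
    ((tendsto_rpow_atTop (by positivity)).const_mul_atTop hb).eventually_gt_atTop K
  have hsmall : ∀ᶠ t : ℝ in Filter.atTop, t ^ (-((1 - κ) / s₂)) < min 1 (min δp δs) :=
    (tendsto_rpow_neg_atTop (div_pos (sub_pos.2 hκ1) hs₂0)).eventually_lt_const (by positivity)
  filter_upwards [Filter.eventually_ge_atTop 1, hlarge, hsmall] with t ht htK htδ
  intro u w N hN hw hgrad x hx hwx
  have ht0 : 0 < t := one_pos.trans_le ht
  have hsx : 0 < s x := hs₁.trans_le (hs x)
  set r := t ^ (-((1 - κ) / s x)) with hr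
  have hrδ : r < min 1 (min δp δs) := by
    refine lt_of_le_of_lt (Real.rpow_le_rpow_of_exponent_le ht (neg_le_neg ?_)) htδ
    exact div_le_div_of_nonneg_left (by linarith) hsx (hs₂ x)
  simp only [lt_min_iff] at hrδ
  obtain ⟨hr1, hrp, hrs⟩ := hrδ
  obtain ⟨y, hy, hyN, hwy⟩ : ∃ y ∈ Metric.ball x r, y ∉ N ∧ w y ≤ ENNReal.ofReal t :=
    exists_mem_ball_le_of_critical hN hb hp₁ hκ hκ1 ht htK hw (hp x) hsx hr
      (hreg x r (by positivity) hr1.le) fun y hy => by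
        linarith [abs_lt.1 (hosc_p (hy.trans hrp))]
  have hsy : s x - ε ≤ s y := by linarith [abs_lt.1 (hosc_s (hy.trans hrs))]
  have hloss : (1 - κ) * s x ≤ s x - 2 * ε := by nlinarith [hs x]
  refine ⟨y, hyN, hwy, ?_⟩
  calc |u x - u y| ≤ r ^ ((1 - κ) * s x) * (2 * t + t) :=
        hgrad.abs_sub_le hx hyN (mul_nonneg (by linarith) hsx.le) (by linarith) (by linarith)
          hr1.le (Metric.mem_ball'.1 hy) (by positivity) hwx ht0.le hwy
    _ = 3 * (t * r ^ ((1 - κ) * s x)) := by ring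
    _ ≤ 3 * t ^ (2 * κ) := by gcongr; exact self_mul_rpow_rpow_le ht hsx

end Descent

section Iteration

variable {α : Type*} {T c η : ℝ}

lemma abs_le_of_descent {A : ℝ} (hT : 1 ≤ T) (hη : 0 < η) (hTA : T ≤ A)
    (hcA : c ≤ A * (2 ^ η - 1)) {u : α → ℝ} {w : α → ℝ≥0∞} {S : Set α}
    (huw : ∀ x ∈ S, ‖u x‖ₑ ≤ w x)
    (hdesc : ∀ t ≥ T, ∀ x ∈ S, w x ≤ ENNReal.ofReal (2 * t) →
      ∃ y ∈ S, w y ≤ ENNReal.ofReal t ∧ |u x - u y| ≤ c * t ^ η) (n : ℕ) :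
    ∀ x ∈ S, w x ≤ ENNReal.ofReal (2 ^ n * T) → |u x| ≤ A * (2 ^ n * T) ^ η := by
  have hT0 : 0 < T := one_pos.trans_le hT
  induction n with
  | zero =>
    intro x hx hwx
    have hu : |u x| ≤ T := by
      rw [← ENNReal.ofReal_le_ofReal_iff hT0.le, ← Real.enorm_eq_ofReal_abs]
      simpa using (huw x hx).trans hwx
    have hTη : 1 ≤ T ^ η := Real.one_le_rpow hT hη.le
    rw [pow_zero, one_mul]
    nlinarith
  | succ n ih =>
    intro x hx hwx
    set t := 2 ^ n * T with ht
    have hTt : T ≤ t := le_mul_of_one_le_left hT0.le (one_le_pow₀ one_le_two)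
    have htwo : 2 ^ (n + 1) * T = 2 * t := by rw [ht, pow_succ']; ring
    rw [htwo] at hwx ⊢
    obtain ⟨y, hy, hwy, hxy⟩ := hdesc t hTt x hx hwx
    calc |u x| ≤ |u y| + |u x - u y| := by simpa using abs_add_le (u y) (u x - u y)
      _ ≤ A * t ^ η + A * (2 ^ η - 1) * t ^ η :=
          add_le_add (ih y hy hwy) (hxy.trans (by gcongr))
      _ = A * (2 * t) ^ η := by
          rw [Real.mul_rpow two_pos.le (hT0.le.trans hTt)]
          ring

lemma exists_enorm_le_of_descent (hT : 1 ≤ T) (hη : 0 < η) :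
    ∃ C : ℝ≥0, 1 ≤ C ∧ ∀ (u : α → ℝ) (w : α → ℝ≥0∞) (S : Set α), (∀ x ∈ S, ‖u x‖ₑ ≤ w x) →
      (∀ t ≥ T, ∀ x ∈ S, w x ≤ ENNReal.ofReal (2 * t) →
        ∃ y ∈ S, w y ≤ ENNReal.ofReal t ∧ |u x - u y| ≤ c * t ^ η) →
      ∀ x ∈ S, ‖u x‖ₑ ≤ C * max 1 (w x) ^ η := by
  have hT0 : 0 < T := one_pos.trans_le hT
  have hη2 : 0 < (2 : ℝ) ^ η - 1 := sub_pos.2 (Real.one_lt_rpow one_lt_two hη)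
  set A := max T (c / (2 ^ η - 1))
  have hTA : T ≤ A := le_max_left _ _
  have hcA : c ≤ A * (2 ^ η - 1) := (div_le_iff₀ hη2).1 (le_max_right _ _)
  have hC : 1 ≤ A * (2 * T) ^ η :=
    one_le_mul_of_one_le_of_one_le (hT.trans hTA) (Real.one_le_rpow (by linarith) hη.le)
  refine ⟨(A * (2 * T) ^ η).toNNReal, Real.one_le_toNNReal.2 hC, fun u w S huw hdesc x hx => ?_⟩
  rcases eq_or_ne (w x) ∞ with htop | htop
  · have hC0 : (((A * (2 * T) ^ η).toNNReal : ℝ≥0) : ℝ≥0∞) ≠ 0 :=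
      (ENNReal.ofReal_pos.2 (by positivity)).ne'
    simp [htop, ENNReal.top_rpow_of_pos hη, ENNReal.mul_top hC0]
  have hmax : max 1 (w x) = ENNReal.ofReal (max 1 (w x).toReal) := by
    rw [ENNReal.ofReal_max, ENNReal.ofReal_one, ENNReal.ofReal_toReal htop]
  set W := max 1 (w x).toReal
  have hW : 1 ≤ W := le_max_left _ _
  obtain ⟨n, hnW, hWn⟩ := exists_nat_pow_near hW one_lt_two
  have hwx : w x ≤ ENNReal.ofReal (2 ^ (n + 1) * T) := calc
    w x ≤ ENNReal.ofReal W := hmax ▸ le_max_right _ _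
    _ ≤ ENNReal.ofReal (2 ^ (n + 1) * T) :=
        ENNReal.ofReal_le_ofReal (hWn.le.trans (le_mul_of_one_le_right (by positivity) hT))
  have hu : |u x| ≤ A * (2 * T) ^ η * W ^ η := calc
    |u x| ≤ A * (2 ^ (n + 1) * T) ^ η := abs_le_of_descent hT hη hTA hcA huw hdesc _ x hx hwx
    _ ≤ A * (2 * T * W) ^ η := by
        gcongr A * ?_ ^ η
        rw [pow_succ]
        nlinarith
    _ = A * (2 * T) ^ η * W ^ η := by
        rw [Real.mul_rpow (by positivity) (by positivity), mul_assoc]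
  rw [Real.enorm_eq_ofReal_abs, hmax, ENNReal.ofReal_rpow_of_pos (by positivity)]
  exact (ENNReal.ofReal_le_ofReal hu).trans_eq (ENNReal.ofReal_mul (by positivity))

end Iteration

lemma rpow_le_mul_rpow_of_le_max_rpow {a w C : ℝ≥0∞} {p β β₂ η : ℝ} (hC : 1 ≤ C) (hp : 0 ≤ p)
    (hpβ : p ≤ β) (hβ : β ≤ β₂) (hη : 0 ≤ η) (hηp : η * β₂ ≤ p) (haw : a ≤ w)
    (ha : a ≤ C * max 1 w ^ η) : a ^ β ≤ C ^ β₂ * w ^ p := by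
  have hβ0 : 0 ≤ β := hp.trans hpβ
  rcases le_total w 1 with hw | hw
  · calc a ^ β ≤ a ^ p := ENNReal.rpow_le_rpow_of_exponent_ge (haw.trans hw) hpβ
      _ ≤ w ^ p := ENNReal.rpow_le_rpow haw hp
      _ ≤ C ^ β₂ * w ^ p := le_mul_of_one_le_left zero_le
          ((ENNReal.one_rpow β₂).ge.trans (ENNReal.rpow_le_rpow hC (hβ0.trans hβ)))
  · rw [max_eq_right hw] at ha
    calc a ^ β ≤ (C * w ^ η) ^ β := ENNReal.rpow_le_rpow ha hβ0
      _ = C ^ β * w ^ (η * β) := by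
          rw [ENNReal.mul_rpow_of_nonneg _ _ hβ0, ENNReal.rpow_mul]
      _ ≤ C ^ β₂ * w ^ p := by
          gcongr ?_ * ?_
          · exact ENNReal.rpow_le_rpow_of_exponent_le hC hβ
          · exact ENNReal.rpow_le_rpow_of_exponent_le hw
              ((mul_le_mul_of_nonneg_left hβ hη).trans hηp)

/-! ### Collapsing the scales of a vector gradient -/

section ScaleSup

variable {X : Type*}

/-- The supremum `sup_{k ≥ 0} 2^{-kε} g_k` over the scales below `1`. It collapses a vector
gradient of order `s` to a single gradient of order `s - ε`. -/
noncomputable def scaleSup (ε : ℝ) (g : ℤ → X → ℝ≥0∞) (x : X) : ℝ≥0∞ :=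
  ⨆ k : ℕ, ENNReal.ofReal (2 ^ (-ε)) ^ k * g k x

lemma exists_nat_mem_dyadic_shell {d : ℝ} (hd0 : 0 < d) (hd1 : d < 1) :
    ∃ k : ℕ, (2 : ℝ) ^ (-(k : ℤ) - 1) ≤ d ∧ d < 2 ^ (-(k : ℤ)) := by
  obtain ⟨n, hnd, hdn⟩ := exists_mem_Ico_zpow hd0 (one_lt_two : (1 : ℝ) < 2)
  have hn : n < 0 := (zpow_lt_one_iff_right₀ one_lt_two).1 (hnd.trans_lt hd1)
  obtain ⟨k, hk⟩ := Int.eq_ofNat_of_zero_le (by omega : 0 ≤ -n - 1)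
  refine ⟨k, ?_, ?_⟩
  · rwa [← hk, show -(-n - 1) - 1 = n by ring]
  · rwa [← hk, show -(-n - 1) = n + 1 by ring]

lemma rpow_mul_le_rpow_sub_mul_scaleSup {ε σ d : ℝ} (hε : 0 ≤ ε) (hd0 : 0 < d) {k : ℕ}
    (hdk : d < 2 ^ (-(k : ℤ))) (g : ℤ → X → ℝ≥0∞) (x : X) :
    ENNReal.ofReal (d ^ σ) * g k x ≤ ENNReal.ofReal (d ^ (σ - ε)) * scaleSup ε g x := by
  have hdε : d ^ ε ≤ ((2 : ℝ) ^ (-ε)) ^ k := calc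
    d ^ ε ≤ ((2 : ℝ) ^ (-(k : ℤ))) ^ ε := by gcongr
    _ = ((2 : ℝ) ^ (-ε)) ^ k := by
      rw [← Real.rpow_intCast, ← Real.rpow_mul two_pos.le, ← Real.rpow_mul_natCast two_pos.le]
      congr 1
      push_cast
      ring
  calc ENNReal.ofReal (d ^ σ) * g k x
      = ENNReal.ofReal (d ^ (σ - ε)) * (ENNReal.ofReal (d ^ ε) * g k x) := by
        rw [← mul_assoc, ← ENNReal.ofReal_mul (by positivity), ← Real.rpow_add hd0,
          sub_add_cancel]
    _ ≤ ENNReal.ofReal (d ^ (σ - ε)) * (ENNReal.ofReal (2 ^ (-ε)) ^ k * g k x) := by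
        rw [← ENNReal.ofReal_pow (by positivity)]
        gcongr
    _ ≤ ENNReal.ofReal (d ^ (σ - ε)) * scaleSup ε g x := by
        gcongr
        exact le_iSup (fun k : ℕ => ENNReal.ofReal (2 ^ (-ε)) ^ k * g k x) k

lemma exists_hasLocalGradientOff_scaleSup [MetricSpace X] [MeasurableSpace X] {μ : Measure X}
    {s u : X → ℝ} {g : ℤ → X → ℝ≥0∞} (hg : g ∈ vectorGradients μ s u) {ε : ℝ} (hε : 0 ≤ ε) :
    ∃ N : Set X, μ N = 0 ∧ HasLocalGradientOff N (fun x => s x - ε) u (scaleSup ε g) := by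
  obtain ⟨-, N, hN, hgN⟩ := hg
  refine ⟨N, hN, fun x hx y hy hd => ?_⟩
  rcases eq_or_ne x y with rfl | hxy
  · simp
  obtain ⟨k, hkd, hdk⟩ := exists_nat_mem_dyadic_shell (dist_pos.2 hxy) hd
  exact (hgN k x y hx hy hkd hdk).trans <| add_le_add
    (rpow_mul_le_rpow_sub_mul_scaleSup hε (dist_pos.2 hxy) hdk g x)
    (rpow_mul_le_rpow_sub_mul_scaleSup hε (dist_pos.2 hxy) hdk g y)

end ScaleSup

/-! ### Modulars and Luxemburg quasi-norms -/

section Modular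

variable {X : Type*} [MeasurableSpace X] {μ : Measure X} {p : X → ℝ} {f : X → ℝ≥0∞}

lemma modular_mono (hp : ∀ᵐ x ∂μ, 0 ≤ p x) {f' : X → ℝ≥0∞} (h : ∀ᵐ x ∂μ, f x ≤ f' x) :
    modular μ p f ≤ modular μ p f' := by
  refine lintegral_mono_ae ?_
  filter_upwards [hp, h] with x hx hff'
  exact ENNReal.rpow_le_rpow hff' hx

lemma modular_max_le (hp : ∀ x, 0 ≤ p x) (hpm : Measurable p) (hf : Measurable f)
    (f' : X → ℝ≥0∞) :
    modular μ p (fun x => max (f x) (f' x)) ≤ modular μ p f + modular μ p f' := calc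
  modular μ p (fun x => max (f x) (f' x)) ≤ ∫⁻ x, f x ^ p x + f' x ^ p x ∂μ := by
    refine lintegral_mono fun x => ?_
    simp only [(ENNReal.monotone_rpow_of_nonneg (hp x)).map_max]
    exact max_le le_self_add le_add_self
  _ = modular μ p f + modular μ p f' := lintegral_add_left (hf.pow hpm) _

lemma modular_scaleSup_le {p₁ : ℝ} (hp₁ : 0 < p₁) (hp : ∀ x, p₁ ≤ p x) (hpm : Measurable p)
    {ε : ℝ} (hε : 0 ≤ ε) {g : ℤ → X → ℝ≥0∞} (hgm : ∀ k, Measurable (g k))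
    (hg : ∀ k, modular μ p (g k) ≤ 1) :
    modular μ p (scaleSup ε g) ≤ (1 - ENNReal.ofReal (2 ^ (-ε)) ^ p₁)⁻¹ := by
  set c := ENNReal.ofReal (2 ^ (-ε))
  have hc : c ≤ 1 :=
    ENNReal.ofReal_le_one.2 (Real.rpow_le_one_of_one_le_of_nonpos one_le_two (neg_nonpos.2 hε))
  have hterm : ∀ (k : ℕ) (x : X), (c ^ k * g k x) ^ p x ≤ (c ^ p₁) ^ k * g k x ^ p x := by
    intro k x
    rw [ENNReal.mul_rpow_of_nonneg _ _ (hp₁.le.trans (hp x)), ← ENNReal.rpow_natCast_mul,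
      ← ENNReal.rpow_mul_natCast, mul_comm p₁]
    gcongr ?_ * _
    exact ENNReal.rpow_le_rpow_of_exponent_ge hc
      (mul_le_mul_of_nonneg_left (hp x) (Nat.cast_nonneg k))
  calc modular μ p (scaleSup ε g) ≤ ∫⁻ x, ∑' k : ℕ, (c ^ p₁) ^ k * g k x ^ p x ∂μ := by
        refine lintegral_mono fun x => ?_
        have hsup : scaleSup ε g x ^ p x = ⨆ k : ℕ, (c ^ k * g k x) ^ p x :=
          (ENNReal.orderIsoRpow (p x) (hp₁.trans_le (hp x))).map_iSup _
        rw [hsup]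
        exact iSup_le fun k => (hterm k x).trans (ENNReal.le_tsum k)
    _ = ∑' k : ℕ, (c ^ p₁) ^ k * modular μ p (g k) := by
        rw [lintegral_tsum fun k => by fun_prop]
        congr 1 with k
        exact lintegral_const_mul _ (by fun_prop)
    _ ≤ ∑' k : ℕ, (c ^ p₁) ^ k := by
        gcongr with k
        exact mul_le_of_le_one_right zero_le (hg k)
    _ = (1 - c ^ p₁)⁻¹ := ENNReal.tsum_geometric _

lemma luxNorm_le {l : ℝ≥0} (hl : 0 < l) (h : modular μ p (fun x => f x / l) ≤ 1) :
    luxNorm μ p f ≤ l :=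
  iInf₂_le l ⟨hl, h⟩

lemma modular_div_le_one_of_luxNorm_lt (hp : ∀ᵐ x ∂μ, 0 ≤ p x) {l : ℝ≥0}
    (h : luxNorm μ p f < l) : modular μ p (fun x => f x / l) ≤ 1 := by
  simp only [luxNorm, iInf_lt_iff] at h
  obtain ⟨m, ⟨-, hm⟩, hml⟩ := h
  exact (modular_mono hp (.of_forall fun x => ENNReal.div_le_div_left hml.le _)).trans hm

lemma luxNorm_mono (hp : ∀ᵐ x ∂μ, 0 ≤ p x) {f' : X → ℝ≥0∞} (h : ∀ᵐ x ∂μ, f x ≤ f' x) :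
    luxNorm μ p f ≤ luxNorm μ p f' :=
  le_iInf₂ fun _ hl => luxNorm_le hl.1 <| le_trans
    (modular_mono hp (h.mono fun _ hx => ENNReal.div_le_div_right hx _)) hl.2

lemma div_coe_mul (a : ℝ≥0∞) {l m : ℝ≥0} (hl : l ≠ 0) :
    a / ((l * m : ℝ≥0) : ℝ≥0∞) = a / l / m := by
  rw [ENNReal.coe_mul, div_eq_mul_inv, div_eq_mul_inv, div_eq_mul_inv,
    ENNReal.mul_inv (.inl (ENNReal.coe_ne_zero.2 hl)) (.inl ENNReal.coe_ne_top), mul_assoc]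

lemma luxNorm_le_mul_luxNorm_div {l : ℝ≥0} (hl : 0 < l) :
    luxNorm μ p f ≤ l * luxNorm μ p (fun x => f x / l) := by
  have hl0 : (l : ℝ≥0∞) ≠ 0 := ENNReal.coe_ne_zero.2 hl.ne'
  rw [← ENNReal.div_le_iff' hl0 ENNReal.coe_ne_top]
  refine le_iInf₂ fun m hm => ?_
  rw [ENNReal.div_le_iff' hl0 ENNReal.coe_ne_top, ← ENNReal.coe_mul]
  refine luxNorm_le (mul_pos hl hm.1) ?_
  simpa only [div_coe_mul _ hl.ne'] using hm.2

lemma luxNorm_le_rpow_of_modular_le {p₁ : ℝ} (hp₁ : 0 < p₁) (hp : ∀ᵐ x ∂μ, p₁ ≤ p x) {K : ℝ≥0}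
    (hK : 1 ≤ K) (hf : modular μ p f ≤ K) : luxNorm μ p f ≤ (K ^ (1 / p₁) : ℝ≥0) := by
  have hK0 : K ≠ 0 := (one_pos.trans_le hK).ne'
  have hK0' : (K : ℝ≥0∞) ≠ 0 := ENNReal.coe_ne_zero.2 hK0
  refine luxNorm_le (NNReal.rpow_pos (one_pos.trans_le hK)) ?_
  set L : ℝ≥0 := K ^ (1 / p₁) with hL
  have hL1 : (L : ℝ≥0∞)⁻¹ ≤ 1 :=
    ENNReal.inv_le_one.2 (by exact_mod_cast NNReal.one_le_rpow hK (by positivity))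
  have hLK : (L : ℝ≥0∞)⁻¹ ^ p₁ = (K : ℝ≥0∞)⁻¹ := by
    rw [ENNReal.inv_rpow, hL, ENNReal.coe_rpow_of_ne_zero hK0, ← ENNReal.rpow_mul,
      one_div_mul_cancel hp₁.ne', ENNReal.rpow_one]
  calc modular μ p (fun x => f x / L) ≤ ∫⁻ x, (K : ℝ≥0∞)⁻¹ * f x ^ p x ∂μ := by
        refine lintegral_mono_ae ?_
        filter_upwards [hp] with x hx
        rw [ENNReal.div_eq_inv_mul, ENNReal.mul_rpow_of_nonneg _ _ (hp₁.le.trans hx), ← hLK]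
        gcongr ?_ * _
        exact ENNReal.rpow_le_rpow_of_exponent_ge hL1 hx
    _ = (K : ℝ≥0∞)⁻¹ * modular μ p f := lintegral_const_mul' _ _ (ENNReal.inv_ne_top.2 hK0')
    _ ≤ (K : ℝ≥0∞)⁻¹ * K := by gcongr
    _ = 1 := ENNReal.inv_mul_cancel hK0' ENNReal.coe_ne_top

lemma modular_lt_top_of_div {p₂ : ℝ} (hp : ∀ᵐ x ∂μ, 0 ≤ p x) (hp₂ : ∀ᵐ x ∂μ, p x ≤ p₂)
    {l : ℝ≥0} (hl : l ≠ 0) (hf : modular μ p (fun x => f x / l) < ∞) : modular μ p f < ∞ := by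
  set L := max (l : ℝ≥0∞) 1
  have hL : 1 ≤ L := le_max_right _ _
  have hLtop : L ^ p₂ ≠ ∞ :=
    ENNReal.rpow_ne_top_of_ne_zero (one_pos.trans_le hL).ne' (by simp [L])
  have hfL : ∀ᵐ x ∂μ, f x ^ p x ≤ L ^ p₂ * (f x / l) ^ p x := by
    filter_upwards [hp, hp₂] with x hx0 hx
    calc f x ^ p x = (l * (f x / l)) ^ p x := by
          rw [ENNReal.mul_div_cancel (ENNReal.coe_ne_zero.2 hl) ENNReal.coe_ne_top]
      _ = (l : ℝ≥0∞) ^ p x * (f x / l) ^ p x := ENNReal.mul_rpow_of_nonneg _ _ hx0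
      _ ≤ L ^ p₂ * (f x / l) ^ p x := by
          gcongr ?_ * _
          exact (ENNReal.rpow_le_rpow (le_max_left _ _) hx0).trans
            (ENNReal.rpow_le_rpow_of_exponent_le hL hx)
  calc modular μ p f ≤ ∫⁻ x, L ^ p₂ * (f x / l) ^ p x ∂μ := lintegral_mono_ae hfL
    _ = L ^ p₂ * modular μ p (fun x => f x / l) := lintegral_const_mul' _ _ hLtop
    _ < ∞ := ENNReal.mul_lt_top hLtop.lt_top hf

lemma luxNorm_lt_top_iff {p₁ p₂ : ℝ} (hp₁ : 0 < p₁) (hp : ∀ᵐ x ∂μ, p₁ ≤ p x)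
    (hp₂ : ∀ᵐ x ∂μ, p x ≤ p₂) : luxNorm μ p f < ∞ ↔ modular μ p f < ∞ := by
  have hp0 : ∀ᵐ x ∂μ, 0 ≤ p x := hp.mono fun x hx => hp₁.le.trans hx
  refine ⟨fun h => ?_, fun h => ?_⟩
  · obtain ⟨l, hfl, -⟩ := ENNReal.lt_iff_exists_nnreal_btwn.1 h
    exact modular_lt_top_of_div hp0 hp₂ (ENNReal.coe_pos.1 (zero_le.trans_lt hfl)).ne'
      ((modular_div_le_one_of_luxNorm_lt hp0 hfl).trans_lt ENNReal.one_lt_top)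
  · have hK : modular μ p f ≤ (max 1 (modular μ p f).toNNReal : ℝ≥0) := by
      rw [ENNReal.coe_max, ENNReal.coe_toNNReal h.ne]
      exact le_max_right _ _
    exact (luxNorm_le_rpow_of_modular_le hp₁ hp (le_max_left _ _) hK).trans_lt ENNReal.coe_lt_top

lemma le_seqNorm {q : ℝ≥0∞} (hq : 0 < q) (a : ℤ → ℝ≥0∞) (k : ℤ) : a k ≤ seqNorm q a := by
  unfold seqNorm
  split_ifs with h
  · exact le_iSup a k
  · have hq' : 0 < q.toReal := ENNReal.toReal_pos hq.ne' h
    rw [one_div, ENNReal.le_rpow_inv_iff hq']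
    exact ENNReal.le_tsum (f := fun k => a k ^ q.toReal) k

lemma luxNorm_le_lpSeqNorm (hp : ∀ᵐ x ∂μ, 0 ≤ p x) {q : X → ℝ≥0∞} (hq : ∀ x, 0 < q x)
    (g : ℤ → X → ℝ≥0∞) (k : ℤ) : luxNorm μ p (g k) ≤ lpSeqNorm μ p q g :=
  luxNorm_mono hp (.of_forall fun x => le_seqNorm (hq x) (fun k => g k x) k)

lemma luxNorm_le_of_seqLpModular_le_one (hp : ∀ᵐ x ∂μ, 0 ≤ p x) {q : X → ℝ≥0∞}
    (hq : 0 < essInf q μ) {g : ℤ → X → ℝ≥0∞} (hg : seqLpModular μ p q g ≤ 1) (k : ℤ) :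
    luxNorm μ p (g k) ≤ (2 ^ ((essInf q μ)⁻¹).toReal : ℝ≥0) := by
  have hlt := ((ENNReal.le_tsum k).trans hg).trans_lt ENNReal.one_lt_two
  simp only [iInf_lt_iff] at hlt
  obtain ⟨a, ⟨-, ha⟩, ha2⟩ := hlt
  refine luxNorm_le (by positivity) ((modular_mono hp ?_).trans ha)
  filter_upwards [ae_essInf_le (μ := μ) (f := q)] with x hx
  refine ENNReal.div_le_div_left ?_ _
  rw [ENNReal.coe_rpow_of_ne_zero two_ne_zero]
  calc (a : ℝ≥0∞) ^ ((q x)⁻¹).toReal ≤ 2 ^ ((q x)⁻¹).toReal := by gcongr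
    _ ≤ 2 ^ ((essInf q μ)⁻¹).toReal := by
        gcongr
        · exact one_le_two
        · exact ENNReal.inv_ne_top.2 hq.ne'

lemma luxNorm_le_mul_seqLpNorm (hp : ∀ᵐ x ∂μ, 0 ≤ p x) {q : X → ℝ≥0∞} (hq : 0 < essInf q μ)
    (g : ℤ → X → ℝ≥0∞) (k : ℤ) :
    luxNorm μ p (g k) ≤ (2 ^ ((essInf q μ)⁻¹).toReal : ℝ≥0) * seqLpNorm μ p q g := by
  have hc0 : ((2 ^ ((essInf q μ)⁻¹).toReal : ℝ≥0) : ℝ≥0∞) ≠ 0 := by simp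
  rw [← ENNReal.div_le_iff' hc0 ENNReal.coe_ne_top]
  refine le_iInf₂ fun l hl => ?_
  rw [ENNReal.div_le_iff' hc0 ENNReal.coe_ne_top, mul_comm]
  exact (luxNorm_le_mul_luxNorm_div hl.1).trans
    (mul_le_mul_right (luxNorm_le_of_seqLpModular_le_one hp hq hl.2 k) _)

end Modular

/-! ### Embeddings -/

lemma enorm_div_coe (a : ℝ) {l : ℝ≥0} (hl : 0 < l) : ‖a / l‖ₑ = ‖a‖ₑ / l := by
  have hl' : (0 : ℝ) < l := hl
  rw [Real.enorm_eq_ofReal_abs, abs_div, abs_of_pos hl', ENNReal.ofReal_div_of_pos hl',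
    ENNReal.ofReal_coe_nnreal, Real.enorm_eq_ofReal_abs]

section Embedding

variable {X : Type*} [MetricSpace X] [MeasurableSpace X] {μ : Measure X} {p s β : X → ℝ}

lemma div_mem_vectorGradients {u : X → ℝ} {g : ℤ → X → ℝ≥0∞} (hg : g ∈ vectorGradients μ s u)
    {l : ℝ≥0} (hl : 0 < l) :
    (fun k x => g k x / l) ∈ vectorGradients μ s (fun x => u x / l) := by
  obtain ⟨hgm, N, hN, h⟩ := hg
  refine ⟨fun k => (hgm k).div_const _, N, hN, fun k x y hx hy hkd hdk => ?_⟩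
  rw [← sub_div, ← Real.enorm_eq_ofReal_abs, enorm_div_coe _ hl, Real.enorm_eq_ofReal_abs,
    ← mul_div_assoc, ← mul_div_assoc, ← ENNReal.add_div]
  exact ENNReal.div_le_div_right (h k x y hx hy hkd hdk) _

variable [BorelSpace X]

lemma exists_enorm_le_of_localGradient (hreg : LowerAhlforsRegular μ fun x => s x * p x)
    (hpc : UniformContinuous p) (hsc : UniformContinuous s) {p₁ s₁ s₂ : ℝ} (hp₁ : 0 < p₁)
    (hp : ∀ x, p₁ ≤ p x) (hs₁ : 0 < s₁) (hs : ∀ x, s₁ ≤ s x) (hs₂ : ∀ x, s x ≤ s₂) {κ ε : ℝ}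
    (hκ : 0 < κ) (hκ1 : κ < 1) (hε : 0 < ε) (hεκ : 2 * ε ≤ κ * s₁) (K : ℝ) :
    ∃ C : ℝ≥0, 1 ≤ C ∧ ∀ (u : X → ℝ) (w : X → ℝ≥0∞) (N : Set X), μ N = 0 →
      modular μ p w ≤ ENNReal.ofReal K → HasLocalGradientOff N (fun x => s x - ε) u w →
      (∀ x, ‖u x‖ₑ ≤ w x) → ∀ x ∉ N, ‖u x‖ₑ ≤ C * max 1 (w x) ^ (2 * κ) := by
  obtain ⟨T, hT⟩ := Filter.eventually_atTop.1 <| (Filter.eventually_ge_atTop 1).and <|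
    eventually_exists_descent hreg hpc hsc hp₁ hp hs₁ hs hs₂ hκ hκ1 hε hεκ K
  obtain ⟨C, hC, h⟩ :=
    exists_enorm_le_of_descent (α := X) (c := 3) (η := 2 * κ) (hT T le_rfl).1 (by positivity)
  exact ⟨C, hC, fun u w N hN hw hgrad huw => h u w Nᶜ (fun x _ => huw x) fun t ht =>
    (hT t ht).2 u w N hN hw hgrad⟩

lemma exists_modular_le_of_localGradient (hreg : LowerAhlforsRegular μ fun x => s x * p x)
    (hpc : UniformContinuous p) (hsc : UniformContinuous s) {p₁ s₁ s₂ β₂ : ℝ} (hp₁ : 0 < p₁)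
    (hp : ∀ x, p₁ ≤ p x) (hs₁ : 0 < s₁) (hs : ∀ x, s₁ ≤ s x) (hs₂ : ∀ x, s x ≤ s₂)
    (hpβ : ∀ᵐ x ∂μ, p x ≤ β x) (hβ₂ : ∀ᵐ x ∂μ, β x ≤ β₂) {κ ε : ℝ} (hκ : 0 < κ) (hκ1 : κ < 1)
    (hκβ : 2 * κ * β₂ ≤ p₁) (hε : 0 < ε) (hεκ : 2 * ε ≤ κ * s₁) (K : ℝ≥0) :
    ∃ K' : ℝ≥0, 1 ≤ K' ∧ ∀ (u : X → ℝ) (w : X → ℝ≥0∞) (N : Set X), μ N = 0 →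
      modular μ p w ≤ K → HasLocalGradientOff N (fun x => s x - ε) u w →
      (∀ x, ‖u x‖ₑ ≤ w x) → modular μ β (fun x => ‖u x‖ₑ) ≤ K' := by
  obtain ⟨C, hC, hCu⟩ :=
    exists_enorm_le_of_localGradient hreg hpc hsc hp₁ hp hs₁ hs hs₂ hκ hκ1 hε hεκ K
  have hC0 : C ≠ 0 := (one_pos.trans_le hC).ne'
  refine ⟨max 1 (C ^ β₂ * K), le_max_left _ _, fun u w N hN hw hgrad huw => ?_⟩
  have huβ : ∀ᵐ x ∂μ, ‖u x‖ₑ ^ β x ≤ (C : ℝ≥0∞) ^ β₂ * w x ^ p x := by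
    filter_upwards [measure_eq_zero_iff_ae_notMem.1 hN, hpβ, hβ₂] with x hx hpx hβx
    exact rpow_le_mul_rpow_of_le_max_rpow (ENNReal.one_le_coe_iff.2 hC) (hp₁.le.trans (hp x))
      hpx hβx (by positivity) (hκβ.trans (hp x)) (huw x)
      (hCu u w N hN (by simpa using hw) hgrad huw x hx)
  calc modular μ β (fun x => ‖u x‖ₑ) ≤ ∫⁻ x, (C : ℝ≥0∞) ^ β₂ * w x ^ p x ∂μ :=
        lintegral_mono_ae huβ
    _ = (C : ℝ≥0∞) ^ β₂ * modular μ p w := lintegral_const_mul' _ _ <|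
        ENNReal.rpow_ne_top_of_ne_zero (ENNReal.coe_ne_zero.2 hC0) ENNReal.coe_ne_top
    _ ≤ (C : ℝ≥0∞) ^ β₂ * K := by gcongr
    _ ≤ (max 1 (C ^ β₂ * K) : ℝ≥0) := by
        rw [← ENNReal.coe_rpow_of_ne_zero hC0, ← ENNReal.coe_mul]
        exact ENNReal.coe_le_coe.2 (le_max_right _ _)

theorem exists_modular_le_of_vectorGradient (hreg : LowerAhlforsRegular μ fun x => s x * p x)
    (hpc : UniformContinuous p) (hsc : UniformContinuous s) {p₁ s₁ s₂ β₂ : ℝ} (hp₁ : 0 < p₁)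
    (hp : ∀ x, p₁ ≤ p x) (hs₁ : 0 < s₁) (hs : ∀ x, s₁ ≤ s x) (hs₂ : ∀ x, s x ≤ s₂)
    (hpβ : ∀ᵐ x ∂μ, p x ≤ β x) (hβ₂ : ∀ᵐ x ∂μ, β x ≤ β₂) :
    ∃ K : ℝ≥0, 1 ≤ K ∧ ∀ u : X → ℝ, Measurable u → ∀ g ∈ vectorGradients μ s u,
      modular μ p (fun x => ‖u x‖ₑ) ≤ 1 → (∀ k, modular μ p (g k) ≤ 1) →
      modular μ β (fun x => ‖u x‖ₑ) ≤ K := by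
  obtain ⟨κ, hκ, hκ1, hκβ⟩ : ∃ κ : ℝ, 0 < κ ∧ κ < 1 ∧ 2 * κ * β₂ ≤ p₁ := by
    refine ⟨min (1 / 2) (p₁ / (2 * max β₂ 1)), by positivity,
      (min_le_left _ _).trans_lt one_half_lt_one, ?_⟩
    calc 2 * min (1 / 2) (p₁ / (2 * max β₂ 1)) * β₂
        ≤ 2 * min (1 / 2) (p₁ / (2 * max β₂ 1)) * max β₂ 1 := by gcongr; exact le_max_left _ _
      _ ≤ 2 * (p₁ / (2 * max β₂ 1)) * max β₂ 1 := by gcongr; exact min_le_right _ _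
      _ = p₁ := by field_simp
  obtain ⟨ε, hε, hεκ⟩ : ∃ ε : ℝ, 0 < ε ∧ 2 * ε ≤ κ * s₁ :=
    ⟨κ * s₁ / 2, by positivity, (mul_div_cancel₀ _ two_ne_zero).le⟩
  have hpm : Measurable p := hpc.continuous.measurable
  have hratio : ENNReal.ofReal (2 ^ (-ε)) ^ p₁ < 1 := ENNReal.rpow_lt_one
    (ENNReal.ofReal_lt_one.2 (Real.rpow_lt_one_of_one_lt_of_neg one_lt_two (neg_neg_iff_pos.2 hε)))
    hp₁
  obtain ⟨K, hK⟩ : ∃ K : ℝ≥0, (K : ℝ≥0∞) = 1 + (1 - ENNReal.ofReal (2 ^ (-ε)) ^ p₁)⁻¹ :=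
    ⟨_, ENNReal.coe_toNNReal <|
      ENNReal.add_ne_top.2 ⟨ENNReal.one_ne_top, ENNReal.inv_ne_top.2 (tsub_pos_of_lt hratio).ne'⟩⟩
  obtain ⟨K', hK', hle⟩ := exists_modular_le_of_localGradient hreg hpc hsc hp₁ hp hs₁ hs hs₂ hpβ
    hβ₂ hκ hκ1 hκβ hε hεκ K
  refine ⟨K', hK', fun u hu g hg hup hgp => ?_⟩
  obtain ⟨N, hN, hgrad⟩ := exists_hasLocalGradientOff_scaleSup hg hε.le
  refine hle u (fun x => max ‖u x‖ₑ (scaleSup ε g x)) N hN ?_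
    (hgrad.mono fun x => le_max_right ‖u x‖ₑ _) fun _ => le_max_left _ _
  rw [hK]
  exact (modular_max_le (fun x => hp₁.le.trans (hp x)) hpm hu.enorm _).trans
    (add_le_add hup (modular_scaleSup_le hp₁ hp hpm hε.le hg.1 hgp))

theorem exists_luxNorm_le_of_vectorGradient (hreg : LowerAhlforsRegular μ fun x => s x * p x)
    (hpc : UniformContinuous p) (hsc : UniformContinuous s) {p₁ s₁ s₂ β₂ : ℝ} (hp₁ : 0 < p₁)
    (hp : ∀ x, p₁ ≤ p x) (hs₁ : 0 < s₁) (hs : ∀ x, s₁ ≤ s x) (hs₂ : ∀ x, s x ≤ s₂)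
    (hpβ : ∀ᵐ x ∂μ, p x ≤ β x) (hβ₂ : ∀ᵐ x ∂μ, β x ≤ β₂) :
    ∃ C : ℝ≥0, 0 < C ∧ ∀ u : X → ℝ, Measurable u → ∀ g ∈ vectorGradients μ s u, ∀ M : ℝ≥0∞,
      luxNorm μ p (fun x => ‖u x‖ₑ) ≤ M → (∀ k, luxNorm μ p (g k) ≤ M) →
      luxNorm μ β (fun x => ‖u x‖ₑ) ≤ C * M := by
  obtain ⟨K, hK, hKu⟩ :=
    exists_modular_le_of_vectorGradient hreg hpc hsc hp₁ hp hs₁ hs hs₂ hpβ hβ₂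
  have hp0 : ∀ᵐ x ∂μ, 0 ≤ p x := .of_forall fun x => hp₁.le.trans (hp x)
  have hβ₁ : ∀ᵐ x ∂μ, p₁ ≤ β x := hpβ.mono fun x hx => (hp x).trans hx
  have hC : 0 < K ^ (1 / p₁) := NNReal.rpow_pos (one_pos.trans_le hK)
  have hC0 : ((K ^ (1 / p₁) : ℝ≥0) : ℝ≥0∞) ≠ 0 := ENNReal.coe_ne_zero.2 hC.ne'
  refine ⟨K ^ (1 / p₁), hC, fun u hu g hg M huM hgM => ?_⟩
  rw [← ENNReal.div_le_iff' hC0 ENNReal.coe_ne_top]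
  refine le_of_forall_gt_imp_ge_of_dense fun a hMa => ?_
  obtain ⟨l, hMl, hla⟩ := ENNReal.lt_iff_exists_nnreal_btwn.1 hMa
  refine le_trans ?_ hla.le
  rw [ENNReal.div_le_iff' hC0 ENNReal.coe_ne_top, mul_comm]
  have hl : 0 < l := ENNReal.coe_pos.1 (zero_le.trans_lt hMl)
  refine (luxNorm_le_mul_luxNorm_div hl).trans (mul_le_mul_right ?_ _)
  refine luxNorm_le_rpow_of_modular_le hp₁ hβ₁ hK ?_
  simp only [← enorm_div_coe _ hl]
  refine hKu (fun x => u x / l) (hu.div_const _) _ (div_mem_vectorGradients hg hl) ?_ fun k =>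
    modular_div_le_one_of_luxNorm_lt hp0 ((hgM k).trans_lt hMl)
  simpa only [enorm_div_coe _ hl] using
    modular_div_le_one_of_luxNorm_lt hp0 (huM.trans_lt hMl)

theorem embedsInLp_of_luxNorm_le (hreg : LowerAhlforsRegular μ fun x => s x * p x)
    (hp : IsBddExponent μ p) (hs : IsBddExponent μ s) (hpc : UniformContinuous p)
    (hsc : UniformContinuous s) (hpβ : ∀ᵐ x ∂μ, p x ≤ β x) (hβ : ∃ β₂, ∀ᵐ x ∂μ, β x ≤ β₂)
    {F : (ℤ → X → ℝ≥0∞) → ℝ≥0∞} {c : ℝ≥0} (hF : ∀ g k, luxNorm μ p (g k) ≤ c * F g) :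
    EmbedsInLp μ {u | u ∈ lpSpace μ p ∧ ⨅ g ∈ vectorGradients μ s u, F g < ∞}
      (fun u => luxNorm μ p (fun x => ‖u x‖ₑ) + ⨅ g ∈ vectorGradients μ s u, F g) β := by
  obtain ⟨p₁, hp₁, hp₁p⟩ := hp.bdd_below
  obtain ⟨p₂, hp₂⟩ := hp.bdd_above
  obtain ⟨s₁, hs₁, hs₁s⟩ := hs.bdd_below
  obtain ⟨s₂, hs₂⟩ := hs.bdd_above
  obtain ⟨β₂, hβ₂⟩ := hβ
  have hopen := hreg.isOpenPosMeasure
  obtain ⟨C, hC0, hC⟩ := exists_luxNorm_le_of_vectorGradient hreg hpc hsc hp₁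
    (forall_le_of_ae_le hpc.continuous hp₁p) hs₁ (forall_le_of_ae_le hsc.continuous hs₁s)
    (forall_ge_of_ae_ge hsc.continuous hs₂) hpβ hβ₂
  have hβ₁ : ∀ᵐ x ∂μ, p₁ ≤ β x := by
    filter_upwards [hp₁p, hpβ] with x hpx hβx using hpx.trans hβx
  refine ⟨C * (1 + c), fun u ⟨⟨hu, hup⟩, hug⟩ => ?_⟩
  set a := luxNorm μ p fun x => ‖u x‖ₑ
  have hle : luxNorm μ β (fun x => ‖u x‖ₑ) ≤
      (C * (1 + c) : ℝ≥0) * (a + ⨅ g ∈ vectorGradients μ s u, F g) := by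
    have hne : ((C * (1 + c) : ℝ≥0) : ℝ≥0∞) ≠ 0 := ENNReal.coe_ne_zero.2 (by positivity)
    rw [ENNReal.add_iInf₂, ← ENNReal.div_le_iff' hne ENNReal.coe_ne_top]
    refine le_iInf₂ fun g hg => ?_
    rw [ENNReal.div_le_iff' hne ENNReal.coe_ne_top, ENNReal.coe_mul, mul_assoc]
    refine hC u hu g hg _ ?_ fun k => (hF g k).trans ?_
    · calc a ≤ 1 * (a + F g) := by simp
        _ ≤ (1 + c : ℝ≥0) * (a + F g) := by gcongr; simp
    · gcongr <;> simp
  refine ⟨⟨hu, ?_⟩, hle⟩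
  rw [← luxNorm_lt_top_iff hp₁ hβ₁ hβ₂]
  refine hle.trans_lt (ENNReal.mul_lt_top ENNReal.coe_lt_top (ENNReal.add_lt_top.2 ⟨?_, hug⟩))
  exact (luxNorm_lt_top_iff hp₁ hp₁p hp₂).2 hup

end Embedding

section SobolevExponent

variable {X : Type*} [MeasurableSpace X] {μ : Measure X} {p s t : X → ℝ}

lemma StronglyLess.ae_le (h : StronglyLess μ s t) : ∀ᵐ x ∂μ, s x ≤ t x := by
  obtain ⟨c, hc, h⟩ := h
  filter_upwards [h] with x hx
  linarith

lemma StronglyLess.ae_le_sobolevExponent (hts : StronglyLess μ t s) (ht : ∀ x, 0 ≤ t x)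
    (hp : ∀ x, 0 < p x) :
    ∀ᵐ x ∂μ, p x ≤ s x * p x * p x / (s x * p x - t x * p x) := by
  obtain ⟨c, hc, hts⟩ := hts
  filter_upwards [hts] with x hx
  have hst : 0 < s x - t x := hc.trans_le hx
  rw [← sub_mul, mul_div_mul_right _ _ (hp x).ne', le_div_iff₀ hst, mul_comm (s x)]
  exact mul_le_mul_of_nonneg_left (sub_le_self _ (ht x)) (hp x).le

lemma StronglyLess.exists_ae_sobolevExponent_le (hts : StronglyLess μ t s)
    (hp : IsBddExponent μ p) (hs : IsBddExponent μ s) :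
    ∃ C : ℝ, ∀ᵐ x ∂μ, s x * p x * p x / (s x * p x - t x * p x) ≤ C := by
  obtain ⟨c, hc, hts⟩ := hts
  obtain ⟨p₂, hp₂⟩ := hp.bdd_above
  obtain ⟨s₂, hs₂⟩ := hs.bdd_above
  refine ⟨s₂ * p₂ / c, ?_⟩
  filter_upwards [hts, hp₂, hs₂] with x hx hpx hsx
  have hp0 := hp.pos x
  have hs0 := hs.pos x
  have hs₂0 : 0 < s₂ := hs0.trans_le hsx
  have hp₂0 : 0 < p₂ := hp0.trans_le hpx
  rw [← sub_mul, mul_div_mul_right _ _ hp0.ne']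
  gcongr

end SobolevExponent

end VarHajlasz

theorem mainTheorem7_general {X : Type*} [MetricSpace X] [MeasurableSpace X] [BorelSpace X]
    {μ : Measure X} {p s : X → ℝ} (hreg : VarHajlasz.LowerAhlforsRegular μ fun x => s x * p x)
    (hp : VarHajlasz.IsBddExponent μ p) (hs : VarHajlasz.IsBddExponent μ s)
    (hpc : UniformContinuous p) (hsc : UniformContinuous s)
    {q : X → ℝ≥0∞} (hq : VarHajlasz.IsExponent μ q)
    {β : X → ℝ} (hpβ : ∀ᵐ x ∂μ, p x ≤ β x) (hβ : ∃ C : ℝ, ∀ᵐ x ∂μ, β x ≤ C) :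
    VarHajlasz.EmbedsInLp μ (VarHajlasz.tlSpace μ s p q) (VarHajlasz.tlNorm μ s p q) β ∧
      VarHajlasz.EmbedsInLp μ (VarHajlasz.besovSpace μ s p q)
        (VarHajlasz.besovNorm μ s p q) β := by
  have hp0 : ∀ᵐ x ∂μ, 0 ≤ p x := .of_forall fun x => (hp.pos x).le
  refine ⟨VarHajlasz.embedsInLp_of_luxNorm_le hreg hp hs hpc hsc hpβ hβ (c := 1) fun g k => ?_,
    VarHajlasz.embedsInLp_of_luxNorm_le hreg hp hs hpc hsc hpβ hβ
      (VarHajlasz.luxNorm_le_mul_seqLpNorm hp0 hq.essInf_pos)⟩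
  simpa using VarHajlasz.luxNorm_le_lpSeqNorm hp0 hq.pos g k

theorem mainTheorem7 {X : Type*} [MetricSpace X] [MeasurableSpace X] [BorelSpace X]
    (μ : Measure X) (hμ : VarHajlasz.IsMetricMeasure μ)
    (hX : VarHajlasz.GeometricallyDoubling X)
    (hball : ∃ δ C : ℝ, 0 < δ ∧ ∀ x : X, μ (Metric.ball x δ) ≤ ENNReal.ofReal C)
    (Q p s : X → ℝ)
    (hQ : VarHajlasz.IsLogExponent μ Q) (hreg : VarHajlasz.LowerAhlforsRegular μ Q)
    (hp : VarHajlasz.IsLogExponent μ p) (hs : VarHajlasz.IsLogExponent μ s)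
    (hspQ : ∀ x, s x * p x = Q x) :
    (∀ q : X → ℝ≥0∞, VarHajlasz.IsExponent μ q →
      ∀ β : X → ℝ, VarHajlasz.IsBddExponent μ β → VarHajlasz.StronglyLess μ p β →
        VarHajlasz.EmbedsInLp μ (VarHajlasz.tlSpace μ s p q) (VarHajlasz.tlNorm μ s p q) β) ∧
    (∀ q : X → ℝ≥0∞, VarHajlasz.IsExponent μ q → (∀ x, q x ≤ ENNReal.ofReal (p x)) →
      ∀ β : X → ℝ, VarHajlasz.IsBddExponent μ β → VarHajlasz.StronglyLess μ p β →
        VarHajlasz.EmbedsInLp μ (VarHajlasz.besovSpace μ s p q)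
          (VarHajlasz.besovNorm μ s p q) β) ∧
    (∀ q : X → ℝ≥0∞, VarHajlasz.IsExponent μ q →
      ∀ t : X → ℝ, VarHajlasz.IsLogExponent μ t → VarHajlasz.StronglyLess μ t s →
        VarHajlasz.EmbedsInLp μ (VarHajlasz.besovSpace μ s p q) (VarHajlasz.besovNorm μ s p q)
          (fun x => Q x * p x / (Q x - t x * p x))) := by
  obtain rfl : (fun x => s x * p x) = Q := funext hspQ
  have hopen := hreg.isOpenPosMeasure
  have embeds {q : X → ℝ≥0∞} (hq : VarHajlasz.IsExponent μ q) {β : X → ℝ} :=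
    mainTheorem7_general hreg hp.toIsBddExponent hs.toIsBddExponent hp.uniformContinuous
      hs.uniformContinuous hq (β := β)
  exact ⟨fun q hq β hβ hpβ => (embeds hq hpβ.ae_le hβ.bdd_above).1,
    fun q hq _ β hβ hpβ => (embeds hq hpβ.ae_le hβ.bdd_above).2,
    fun q hq t ht hts => (embeds hq (hts.ae_le_sobolevExponent (fun x => (ht.pos x).le) hp.pos)
      (hts.exists_ae_sobolevExponent_le hp.toIsBddExponent hs.toIsBddExponent)).2⟩
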